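/- For a poset $P$, let $\mathbf{Co}(P)$ denote the lattice, under inclusion, of all order-convex subsets of $P$ (those $X\subseteq P$ such that $x\le z\le y$ and $x,y\in X$ imply $z\in X$). The length of $P$ is the supremum of the numbers $|C|-1$, where $C$ ranges over the finite chains of $P$. Let $\prec$ be the covering relation of $P$. The poset $P$ is tree-like if it has no infinite bounded chain and, for all $a,b\in P$, there is at most one finite sequence $x_0,\dots,x_n$ of distinct elements of $P$ with $x_0=a$, $x_n=b$ and, for each $i<n$, $x_i\prec x_{i+1}$ or $x_{i+1}\prec x_i$. Let $\mathbf{SUB}_2$ be the class of all lattices that can be embedded (as lattices) into $\mathbf{Co}(P)$ for some poset $P$ of length at most $2$. Consider the lattice identities $$(\mathrm L_2)\quad a\wedge\bigl((b\wedge(c\vee c'))\vee b'\bigr)=\bigl(a\wedge b\wedge(c\vee c')\bigr)\vee\bigl(a\wedge((b\wedge c)\vee b')\bigr)\vee\bigl(a\wedge((b\wedge c')\vee b')\bigr),$$ $$(\mathrm U)\quad x\wedge(x_0\vee x_1)\wedge(x_1\vee x_2)\wedge(x_0\vee x_2)=\bigl(x\wedge x_0\wedge(x_1\vee x_2)\bigr)\vee\bigl(x\wedge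 x_1\wedge(x_0\vee x_2)\bigr)\vee\bigl(x\wedge x_2\wedge(x_0\vee x_1)\bigr),$$ $$(\mathrm B)\quad x\wedge(a_0\vee a_1)\wedge(b_0\vee b_1)=\bigvee_{i<2}\Bigl(\bigl(x\wedge a_i\wedge(b_0\vee b_1)\bigr)\vee\bigl(x\wedge b_i\wedge(a_0\vee a_1)\bigr)\Bigr)\vee\bigvee_{i<2}\bigl(x\wedge(a_0\vee a_1)\wedge(b_0\vee b_1)\wedge(a_0\vee b_i)\wedge(a_1\vee b_{1-i})\bigr).$$ **Theorem.** Let $L$ be a lattice. Then the following are equivalent: 1. $L$ belongs to $\mathbf{SUB}_2$. 2. $L$ satisfies the identities $(\mathrm L_2)$, $(\mathrm U)$ and $(\mathrm B)$. 3. There are a tree-like poset $\Gamma$ of length at most $2$ and a lattice embedding $\varphi\colon L\hookrightarrow\mathbf{Co}(\Gamma)$ that preserves the existing bounds (the least element of $L$, if there is one, is sent to $\varnothing$, and the greatest element of $L$, if there is one, is sent to $\Gamma$), such that moreover: if $L$ is finite, then $\Gamma$ is finite; and if $L$ is finite and subdirectly irreducible (that is, it has a least congruence among those different from equality), then $\varphi$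 sends every atom of $L$ to an atom of $\mathbf{Co}(\Gamma)$. -/

import Mathlib

universe u

/-- The poset `Co P` of all order-convex subsets of a poset `P`: those `X ⊆ P` such that
`x ≤ z ≤ y` and `x, y ∈ X` imply `z ∈ X` (this is `Set.OrdConnected`), ordered by inclusion. -/
def Co (P : Type u) [PartialOrder P] : Type u := {X : Set P // X.OrdConnected}

namespace Co

variable {P : Type u} [PartialOrder P]

/-- The least order-convex set containing `X`: all points between two points of `X`. -/
def hull (X : Set P) : Co P :=
  ⟨{z | ∃ x ∈ X, ∃ y ∈ X, x ≤ z ∧ z ≤ y}, ⟨by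
    rintro a ⟨x, hx, _, _, hxa, _⟩ b ⟨_, _, y, hy, _, hby⟩ z ⟨haz, hzb⟩
    exact ⟨x, hx, y, hy, hxa.trans haz, hzb.trans hby⟩⟩⟩

theorem subset_hull (X : Set P) : X ⊆ (hull X).1 :=
  fun x hx => ⟨x, hx, x, hx, le_rfl, le_rfl⟩

theorem hull_subset {X : Set P} {Y : Co P} (h : X ⊆ Y.1) : (hull X).1 ⊆ Y.1 := by
  rintro z ⟨x, hx, y, hy, hxz, hzy⟩
  exact Y.2.out (h hx) (h hy) ⟨hxz, hzy⟩

instance : PartialOrder (Co P) :=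
  PartialOrder.lift (fun X : Co P => X.1) Subtype.val_injective

/-- `Co P` is a lattice under inclusion; the meet is the intersection and the join is the
order-convex hull of the union. -/
instance : Lattice (Co P) where
  sup X Y := hull (X.1 ∪ Y.1)
  inf X Y := ⟨X.1 ∩ Y.1, X.2.inter Y.2⟩
  le_sup_left _ _ := Set.subset_union_left.trans (subset_hull _)
  le_sup_right _ _ := Set.subset_union_right.trans (subset_hull _)
  sup_le _ _ _ hX hY := hull_subset (Set.union_subset hX hY)
  inf_le_left _ _ := Set.inter_subset_left
  inf_le_right _ _ := Set.inter_subset_right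
  le_inf _ _ _ hX hY := Set.subset_inter hX hY

/-- The bounds of `Co P` are `∅` and `P`. -/
instance : BoundedOrder (Co P) where
  bot := ⟨∅, Set.ordConnected_empty⟩
  bot_le X := Set.empty_subset X.1
  top := ⟨Set.univ, Set.ordConnected_univ⟩
  le_top X := Set.subset_univ X.1

end Co

/-- `P` has length at most `n`: every finite chain of `P` has at most `n + 1` elements. -/
def LengthLE (n : ℕ) (P : Type u) [PartialOrder P] : Prop :=
  ∀ C : Finset P, IsChain (· ≤ ·) (C : Set P) → C.card ≤ n + 1

/-- A poset is tree-like if it has no infinite bounded chain and any two points `a`, `b` are joined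
by at most one finite sequence of distinct points `a = x₀, …, xₙ = b` in which consecutive points
are related by the covering relation (in one direction or the other), that is, by at most one path
of the Hasse diagram. -/
def TreeLike (P : Type u) [PartialOrder P] : Prop :=
  (∀ C : Set P, IsChain (· ≤ ·) C → BddBelow C → BddAbove C → C.Finite) ∧
  ∀ (a b : P) (p q : (SimpleGraph.hasse P).Path a b), p = q

/-- The class `SUB n` of all lattices that can be embedded into `Co P` for some poset `P` of
length at most `n`. -/
def MemSUB (n : ℕ) (L : Type u) [Lattice L] : Prop :=
  ∃ (P : Type u) (_ : PartialOrder P), LengthLE n P ∧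
    ∃ φ : LatticeHom L (Co P), Function.Injective φ

/-- The identity (L₂). -/
def IdentityL2 (L : Type u) [Lattice L] : Prop :=
  ∀ a b b' c c' : L,
    a ⊓ ((b ⊓ (c ⊔ c')) ⊔ b') =
      (a ⊓ b ⊓ (c ⊔ c')) ⊔ (a ⊓ ((b ⊓ c) ⊔ b')) ⊔ (a ⊓ ((b ⊓ c') ⊔ b'))

/-- The Udav identity (U). -/
def IdentityU (L : Type u) [Lattice L] : Prop :=
  ∀ x x₀ x₁ x₂ : L,
    x ⊓ (x₀ ⊔ x₁) ⊓ (x₁ ⊔ x₂) ⊓ (x₀ ⊔ x₂) =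
      (x ⊓ x₀ ⊓ (x₁ ⊔ x₂)) ⊔ (x ⊓ x₁ ⊓ (x₀ ⊔ x₂)) ⊔ (x ⊓ x₂ ⊓ (x₀ ⊔ x₁))

/-- The Bond identity (B). -/
def IdentityB (L : Type u) [Lattice L] : Prop :=
  ∀ x a₀ a₁ b₀ b₁ : L,
    x ⊓ (a₀ ⊔ a₁) ⊓ (b₀ ⊔ b₁) =
      ((x ⊓ a₀ ⊓ (b₀ ⊔ b₁)) ⊔ (x ⊓ b₀ ⊓ (a₀ ⊔ a₁))) ⊔
      ((x ⊓ a₁ ⊓ (b₀ ⊔ b₁)) ⊔ (x ⊓ b₁ ⊓ (a₀ ⊔ a₁))) ⊔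
      ((x ⊓ (a₀ ⊔ a₁) ⊓ (b₀ ⊔ b₁) ⊓ (a₀ ⊔ b₀) ⊓ (a₁ ⊔ b₁)) ⊔
        (x ⊓ (a₀ ⊔ a₁) ⊓ (b₀ ⊔ b₁) ⊓ (a₀ ⊔ b₁) ⊓ (a₁ ⊔ b₀)))

/-- `φ` preserves the existing bounds: it sends the least (greatest) element of `L`, if there is
one, to the least (greatest) element of `M`. -/
def PreservesBounds {L M : Type u} [Lattice L] [Lattice M] (φ : LatticeHom L M) : Prop :=
  (∀ x : L, IsBot x → IsBot (φ x)) ∧ (∀ x : L, IsTop x → IsTop (φ x))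

/-- `x` is an atom: it covers the least element of the lattice. -/
def IsLatticeAtom {L : Type u} [Lattice L] (x : L) : Prop :=
  ∃ z : L, IsBot z ∧ z ⋖ x

/-- `φ` sends atoms to atoms. -/
def PreservesAtoms {L M : Type u} [Lattice L] [Lattice M] (φ : LatticeHom L M) : Prop :=
  ∀ x : L, IsLatticeAtom x → IsLatticeAtom (φ x)

/-- A congruence is nontrivial if it identifies two distinct elements. -/
def NontrivialCon {L : Type u} [Lattice L] (θ : LatticeCon L) : Prop :=
  ∃ x y : L, x ≠ y ∧ θ.r x y

/-- `L` is subdirectly irreducible: it has a least nontrivial congruence. -/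
def SubdirectlyIrreducible (L : Type u) [Lattice L] : Prop :=
  ∃ μ : LatticeCon L, NontrivialCon μ ∧
    ∀ θ : LatticeCon L, NontrivialCon θ → ∀ x y : L, μ.r x y → θ.r x y

/-! A point of a join in `Co P` outside both parts lies between a point of one part and a point of
the other, and a convex set that misses a point `z` cannot have points both below and above `z`. So
(U) and (B) hold in every `Co P`; (L₂) uses that in length 2 a point below a non-maximal point has
nothing below it.

For the converse, points are made from filters. Given an irreducible filter `q`, draw an edge
between `u, v ∉ q` when `u ⊔ v ∈ q`. By (U) this graph has no triangle, and by (B) any two edges are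
linked by two further edges that pair up their endpoints. Hence its non-isolated vertices form a
complete bipartite graph. By (L₂) each edge extends to a pair of prime filters, one on each side
(`exists_primeFilter_pair`, `exists_sides`). A star with middle point `q`, the prime filters of one
side below it and those of the other above it represents exactly these covers.

Sending `x` to the points whose label contains `x` is a homomorphism. It is injective on the union
of all stars because irreducible filters separate elements. The map of a subdirectly irreducible
lattice is already injective on one star, where points are determined by their labels; this gives
the statement on atoms. -/

/-! ### Joins of order-convex sets -/

namespace Co

variable {P : Type u} [PartialOrder P]

theorem mem_sup {X Y : Co P} {z : P} :
    z ∈ (X ⊔ Y).1 ↔ ∃ x, (x ∈ X.1 ∨ x ∈ Y.1) ∧ ∃ y, (y ∈ X.1 ∨ y ∈ Y.1) ∧ x ≤ z ∧ z ≤ y :=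
  Iff.rfl

theorem mem_of_le {X Y : Co P} (h : X ≤ Y) {z : P} (hz : z ∈ X.1) : z ∈ Y.1 := h hz

theorem mem_sup_left {X Y : Co P} {z : P} (h : z ∈ X.1) : z ∈ (X ⊔ Y).1 :=
  mem_of_le le_sup_left h

theorem mem_sup_right {X Y : Co P} {z : P} (h : z ∈ Y.1) : z ∈ (X ⊔ Y).1 :=
  mem_of_le le_sup_right h

theorem mem_of_le_of_le (X : Co P) {x y z : P} (hx : x ∈ X.1) (hy : y ∈ X.1) (hxz : x ≤ z)
    (hzy : z ≤ y) : z ∈ X.1 :=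
  X.2.out hx hy ⟨hxz, hzy⟩

/-- A point of a join that lies in neither part lies above a point of one part and below a point
of the other. -/
theorem mem_sup_cases {X Y : Co P} {z : P} (h : z ∈ (X ⊔ Y).1) :
    z ∈ X.1 ∨ z ∈ Y.1 ∨ (∃ x ∈ X.1, ∃ y ∈ Y.1, x ≤ z ∧ z ≤ y) ∨
      (∃ y ∈ Y.1, ∃ x ∈ X.1, y ≤ z ∧ z ≤ x) := by
  obtain ⟨x, hx | hx, y, hy | hy, hxz, hzy⟩ := mem_sup.1 h
  · exact .inl (X.mem_of_le_of_le hx hy hxz hzy)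
  · exact .inr (.inr (.inl ⟨x, hx, y, hy, hxz, hzy⟩))
  · exact .inr (.inr (.inr ⟨x, hx, y, hy, hxz, hzy⟩))
  · exact .inr (.inl (Y.mem_of_le_of_le hx hy hxz hzy))

theorem mem_sup_of_le_of_le {X Y : Co P} {x y z : P} (hx : x ∈ X.1) (hy : y ∈ Y.1) (hxz : x ≤ z)
    (hzy : z ≤ y) : z ∈ (X ⊔ Y).1 :=
  mem_of_le_of_le _ (mem_sup_left hx) (mem_sup_right hy) hxz hzy

theorem mem_sup_of_ge_of_ge {X Y : Co P} {x y z : P} (hx : x ∈ X.1) (hy : y ∈ Y.1) (hxz : z ≤ x)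
    (hzy : y ≤ z) : z ∈ (X ⊔ Y).1 :=
  mem_of_le_of_le _ (mem_sup_right hy) (mem_sup_left hx) hzy hxz

end Co

/-! ### The identities in lattices of order-convex sets -/

theorem LengthLE.not_lt_lt_lt {P : Type u} [PartialOrder P] (h : LengthLE 2 P) {w x y z : P}
    (hwx : w < x) (hxy : x < y) (hyz : y < z) : False := by
  classical
  have hc := h {w, x, y, z} (by
    intro a ha b hb _
    simp only [Finset.coe_insert, Finset.coe_singleton, Set.mem_insert_iff,
      Set.mem_singleton_iff] at ha hb
    have := hwx.le
    have := hxy.le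
    have := hyz.le
    rcases ha with rfl | rfl | rfl | rfl <;> rcases hb with rfl | rfl | rfl | rfl <;> grind)
  rw [Finset.card_eq_of_equiv_fin (n := 4)] at hc
  · omega
  · refine Fintype.equivFinOfCardEq ?_
    rw [Fintype.card_coe, Finset.card_insert_of_notMem, Finset.card_insert_of_notMem,
      Finset.card_pair hyz.ne]
    · simp [hxy.ne, (hxy.trans hyz).ne]
    · simp [hwx.ne, (hwx.trans hxy).ne, (hwx.trans (hxy.trans hyz)).ne]

theorem identityL2_Co {P : Type u} [PartialOrder P] (hP : LengthLE 2 P) : IdentityL2 (Co P) := by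
  intro a b b' c c'
  apply le_antisymm
  · rintro z ⟨hza, hz⟩
    by_cases h1 : z ∈ (b ⊓ (c ⊔ c')).1
    · exact Co.mem_sup_left (Co.mem_sup_left ⟨⟨hza, h1.1⟩, h1.2⟩)
    by_cases h2 : z ∈ b'.1
    · exact Co.mem_sup_left (Co.mem_sup_right ⟨hza, Co.mem_sup_right h2⟩)
    obtain ⟨x, hx, y, hy, hxz, hzy⟩ := Co.mem_sup.1 hz
    have hxz' : x < z := lt_of_le_of_ne hxz (by rintro rfl; tauto)
    have hzy' : z < y := lt_of_le_of_ne hzy (by rintro rfl; tauto)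
    -- As `x < z < y` is already a chain of maximal size, `x` is minimal and `y` maximal. An
    -- endpoint in `c ⊔ c'` must therefore lie in `c` or in `c'`.
    have hx' : x ∈ (b ⊓ c).1 ∨ x ∈ (b ⊓ c').1 ∨ x ∈ b'.1 := by
      rcases hx with ⟨hxb, u, hu, v, hv, hux, hxv⟩ | hx
      · have : u = x := by
          by_contra hne
          exact hP.not_lt_lt_lt (lt_of_le_of_ne hux hne) hxz' hzy'
        subst this
        rcases hu with hu | hu
        · exact .inl ⟨hxb, hu⟩
        · exact .inr (.inl ⟨hxb, hu⟩)
      · exact .inr (.inr hx)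
    have hy' : y ∈ (b ⊓ c).1 ∨ y ∈ (b ⊓ c').1 ∨ y ∈ b'.1 := by
      rcases hy with ⟨hyb, u, hu, v, hv, huy, hyv⟩ | hy
      · have : y = v := by
          by_contra hne
          exact hP.not_lt_lt_lt hxz' hzy' (lt_of_le_of_ne hyv hne)
        subst this
        rcases hv with hv | hv
        · exact .inl ⟨hyb, hv⟩
        · exact .inr (.inl ⟨hyb, hv⟩)
      · exact .inr (.inr hy)
    have left : ∀ {u v : P}, (u ∈ (b ⊓ c).1 ∨ u ∈ b'.1) → (v ∈ (b ⊓ c).1 ∨ v ∈ b'.1) →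
        u ≤ z → z ≤ v → z ∈ ((a ⊓ b ⊓ (c ⊔ c')) ⊔ (a ⊓ ((b ⊓ c) ⊔ b')) ⊔
          (a ⊓ ((b ⊓ c') ⊔ b'))).1 := fun hu hv huz hzv =>
      Co.mem_sup_left (Co.mem_sup_right ⟨hza, _, hu, _, hv, huz, hzv⟩)
    have right : ∀ {u v : P}, (u ∈ (b ⊓ c').1 ∨ u ∈ b'.1) → (v ∈ (b ⊓ c').1 ∨ v ∈ b'.1) →
        u ≤ z → z ≤ v → z ∈ ((a ⊓ b ⊓ (c ⊔ c')) ⊔ (a ⊓ ((b ⊓ c) ⊔ b')) ⊔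
          (a ⊓ ((b ⊓ c') ⊔ b'))).1 := fun hu hv huz hzv =>
      Co.mem_sup_right ⟨hza, _, hu, _, hv, huz, hzv⟩
    rcases hx' with hx' | hx' | hx' <;> rcases hy' with hy' | hy' | hy'
    · exact left (.inl hx') (.inl hy') hxz hzy
    · exact absurd ⟨b.mem_of_le_of_le hx'.1 hy'.1 hxz hzy,
        Co.mem_sup_of_le_of_le hx'.2 hy'.2 hxz hzy⟩ h1
    · exact left (.inl hx') (.inr hy') hxz hzy
    · exact absurd ⟨b.mem_of_le_of_le hx'.1 hy'.1 hxz hzy,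
        Co.mem_sup_of_ge_of_ge hy'.2 hx'.2 hzy hxz⟩ h1
    · exact right (.inl hx') (.inl hy') hxz hzy
    · exact right (.inl hx') (.inr hy') hxz hzy
    · exact left (.inr hx') (.inl hy') hxz hzy
    · exact right (.inr hx') (.inl hy') hxz hzy
    · exact left (.inr hx') (.inr hy') hxz hzy
  · refine sup_le (sup_le ?_ ?_) ?_
    · exact le_inf (inf_le_left.trans inf_le_left)
        ((le_inf (inf_le_left.trans inf_le_right) inf_le_right).trans le_sup_left)
    · exact inf_le_inf_left _ (sup_le_sup_right (inf_le_inf_left _ le_sup_left) _)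
    · exact inf_le_inf_left _ (sup_le_sup_right (inf_le_inf_left _ le_sup_right) _)

/-- If `z` avoids all three `xᵢ`, each `xᵢ` has points on only one side of `z`, while each join
forces its two parts onto opposite sides. Three sets cannot be pairwise opposite with only two
sides. -/
theorem identityU_Co (P : Type u) [PartialOrder P] : IdentityU (Co P) := by
  intro x x₀ x₁ x₂
  apply le_antisymm
  · rintro z ⟨⟨⟨hx, h01⟩, h12⟩, h02⟩
    by_cases h0 : z ∈ x₀.1
    · exact Co.mem_sup_left (Co.mem_sup_left ⟨⟨hx, h0⟩, h12⟩)
    by_cases h1 : z ∈ x₁.1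
    · exact Co.mem_sup_left (Co.mem_sup_right ⟨⟨hx, h1⟩, h02⟩)
    by_cases h2 : z ∈ x₂.1
    · exact Co.mem_sup_right ⟨⟨hx, h2⟩, h01⟩
    exfalso
    rcases Co.mem_sup_cases h01 with h | h | ⟨u, hu, v, hv, huz, hzv⟩ | ⟨u, hu, v, hv, huz, hzv⟩
    · exact h0 h
    · exact h1 h
    all_goals
      rcases Co.mem_sup_cases h12 with h | h | ⟨s, hs, t, ht, hsz, hzt⟩ | ⟨s, hs, t, ht, hsz, hzt⟩
      · exact h1 h
      · exact h2 h
    all_goals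
      rcases Co.mem_sup_cases h02 with h | h | ⟨p, hp, q, hq, hpz, hzq⟩ | ⟨p, hp, q, hq, hpz, hzq⟩
      · exact h0 h
      · exact h2 h
    all_goals
      have m0 := @Co.mem_of_le_of_le P _ x₀
      have m1 := @Co.mem_of_le_of_le P _ x₁
      have m2 := @Co.mem_of_le_of_le P _ x₂
      grind
  · refine sup_le (sup_le ?_ ?_) ?_ <;> refine le_inf (le_inf (le_inf ?_ ?_) ?_) ?_
    all_goals first
      | exact inf_le_left.trans inf_le_left
      | exact inf_le_right
      | exact inf_le_left.trans (inf_le_right.trans le_sup_left)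
      | exact inf_le_left.trans (inf_le_right.trans le_sup_right)

/-- If `z` avoids all four sets, `a₀, a₁` have points on opposite sides of `z`, and so do `b₀, b₁`.
Each `aᵢ` then pairs with the `bⱼ` on the other side, which gives one of the last two terms. -/
theorem identityB_Co (P : Type u) [PartialOrder P] : IdentityB (Co P) := by
  intro x a₀ a₁ b₀ b₁
  apply le_antisymm
  · rintro z ⟨⟨hx, ha⟩, hb⟩
    by_cases ha0 : z ∈ a₀.1
    · exact Co.mem_sup_left (Co.mem_sup_left (Co.mem_sup_left ⟨⟨hx, ha0⟩, hb⟩))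
    by_cases hb0 : z ∈ b₀.1
    · exact Co.mem_sup_left (Co.mem_sup_left (Co.mem_sup_right ⟨⟨hx, hb0⟩, ha⟩))
    by_cases ha1 : z ∈ a₁.1
    · exact Co.mem_sup_left (Co.mem_sup_right (Co.mem_sup_left ⟨⟨hx, ha1⟩, hb⟩))
    by_cases hb1 : z ∈ b₁.1
    · exact Co.mem_sup_left (Co.mem_sup_right (Co.mem_sup_right ⟨⟨hx, hb1⟩, ha⟩))
    refine Co.mem_sup_right ?_
    rcases Co.mem_sup_cases ha with h | h | ⟨u, hu, v, hv, huz, hzv⟩ | ⟨u, hu, v, hv, huz, hzv⟩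
    · exact absurd h ha0
    · exact absurd h ha1
    all_goals
      rcases Co.mem_sup_cases hb with h | h | ⟨s, hs, t, ht, hsz, hzt⟩ | ⟨s, hs, t, ht, hsz, hzt⟩
      · exact absurd h hb0
      · exact absurd h hb1
    · exact Co.mem_sup_right ⟨⟨⟨⟨hx, ha⟩, hb⟩, Co.mem_sup_of_le_of_le hu ht huz hzt⟩,
        Co.mem_sup_of_ge_of_ge hv hs hzv hsz⟩
    · exact Co.mem_sup_left ⟨⟨⟨⟨hx, ha⟩, hb⟩, Co.mem_sup_of_le_of_le hu ht huz hzt⟩,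
        Co.mem_sup_of_ge_of_ge hv hs hzv hsz⟩
    · exact Co.mem_sup_left ⟨⟨⟨⟨hx, ha⟩, hb⟩, Co.mem_sup_of_ge_of_ge hv hs hzv hsz⟩,
        Co.mem_sup_of_le_of_le hu ht huz hzt⟩
    · exact Co.mem_sup_right ⟨⟨⟨⟨hx, ha⟩, hb⟩, Co.mem_sup_of_ge_of_ge hv hs hzv hsz⟩,
        Co.mem_sup_of_le_of_le hu ht huz hzt⟩
  · refine sup_le (sup_le (sup_le ?_ ?_) (sup_le ?_ ?_)) (sup_le ?_ ?_)
    any_goals exact inf_le_left.trans inf_le_left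
    all_goals refine le_inf (le_inf ?_ ?_) ?_
    all_goals first
      | exact inf_le_left.trans inf_le_left
      | exact inf_le_right
      | exact inf_le_left.trans (inf_le_right.trans le_sup_left)
      | exact inf_le_left.trans (inf_le_right.trans le_sup_right)

theorem MemSUB.identities {L : Type u} [Lattice L] (h : MemSUB 2 L) :
    IdentityL2 L ∧ IdentityU L ∧ IdentityB L := by
  obtain ⟨P, _, hP, φ, hφ⟩ := h
  refine ⟨fun a b b' c c' => hφ ?_, fun x x₀ x₁ x₂ => hφ ?_, fun x a₀ a₁ b₀ b₁ => hφ ?_⟩ <;>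
    simp only [map_inf, map_sup]
  · exact identityL2_Co hP _ _ _ _ _
  · exact identityU_Co P _ _ _ _
  · exact identityB_Co P _ _ _ _ _

/-! ### Irreducible and prime filters -/

/-- `F` is a (nonempty) filter of the lattice `L`. -/
structure IsLatticeFilter {L : Type u} [Lattice L] (F : Set L) : Prop where
  nonempty : F.Nonempty
  upper : ∀ {x y : L}, x ≤ y → x ∈ F → y ∈ F
  inf : ∀ {x y : L}, x ∈ F → y ∈ F → x ⊓ y ∈ F

/-- A proper filter is irreducible if it is not the intersection of two larger filters; this is
expressed in terms of generators of the two filters. -/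
structure IsIrreducibleFilter {L : Type u} [Lattice L] (F : Set L) : Prop
    extends IsLatticeFilter F where
  proper : ∃ x, x ∉ F
  irreducible : ∀ {u v : L}, u ∉ F → v ∉ F → ∃ a ∈ F, (a ⊓ u) ⊔ (a ⊓ v) ∉ F

/-- A proper filter is prime if it contains a member of every join that it contains. -/
structure IsPrimeFilter {L : Type u} [Lattice L] (F : Set L) : Prop
    extends IsLatticeFilter F where
  proper : ∃ x, x ∉ F
  prime : ∀ {u v : L}, u ⊔ v ∈ F → u ∈ F ∨ v ∈ F

section Filters

variable {L : Type u} [Lattice L]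

theorem isLatticeFilter_Ici (x : L) : IsLatticeFilter (Set.Ici x) :=
  ⟨⟨x, le_rfl⟩, fun h hx => le_trans (α := L) hx h, fun hx hy => le_inf hx hy⟩

/-- A filter contained in a set `S` is contained in a maximal such filter `M`, and then meeting
the elements of `M` with an element outside `M` leads outside `S`. -/
theorem IsLatticeFilter.exists_maximal {F S : Set L} (hF : IsLatticeFilter F) (hFS : F ⊆ S)
    (hS : ∀ {x y : L}, x ≤ y → x ∈ S → y ∈ S) :
    ∃ M, IsLatticeFilter M ∧ F ⊆ M ∧ M ⊆ S ∧ ∀ c, c ∉ M → ∃ w ∈ M, w ⊓ c ∉ S := by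
  obtain ⟨M, hFM, hM⟩ := zorn_subset_nonempty {M : Set L | IsLatticeFilter M ∧ M ⊆ S} (by
    rintro C hC hchain ⟨N, hN⟩
    refine ⟨⋃₀ C, ⟨⟨?_, ?_, ?_⟩, Set.sUnion_subset fun M hM => (hC hM).2⟩,
      fun M hM => Set.subset_sUnion_of_mem hM⟩
    · exact (hC hN).1.nonempty.mono (Set.subset_sUnion_of_mem hN)
    · rintro x y hxy ⟨M, hM, hx⟩
      exact ⟨M, hM, (hC hM).1.upper hxy hx⟩
    · rintro x y ⟨M, hM, hx⟩ ⟨M', hM', hy⟩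
      rcases hchain.total hM hM' with h | h
      · exact ⟨M', hM', (hC hM').1.inf (h hx) hy⟩
      · exact ⟨M, hM, (hC hM).1.inf hx (h hy)⟩) F ⟨hF, hFS⟩
  refine ⟨M, hM.prop.1, hFM, hM.prop.2, fun c hc => ?_⟩
  by_contra! hcon
  obtain ⟨m, hm⟩ := hM.prop.1.nonempty
  have hle : M ⊆ {z | ∃ w ∈ M, w ⊓ c ≤ z} := fun w hw => ⟨w, hw, inf_le_left⟩
  have hmem : {z | ∃ w ∈ M, w ⊓ c ≤ z} ∈ {M : Set L | IsLatticeFilter M ∧ M ⊆ S} := by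
    refine ⟨⟨⟨m, hle hm⟩, ?_, ?_⟩, ?_⟩
    · rintro x y hxy ⟨w, hw, hwx⟩
      exact ⟨w, hw, hwx.trans hxy⟩
    · rintro x y ⟨w, hw, hwx⟩ ⟨w', hw', hwy⟩
      exact ⟨w ⊓ w', hM.prop.1.inf hw hw', le_inf
        ((inf_le_inf_right _ inf_le_left).trans hwx) ((inf_le_inf_right _ inf_le_right).trans hwy)⟩
    · rintro x ⟨w, hw, hwx⟩
      exact hS hwx (hcon w hw)
  exact hc (hM.le_of_ge hmem hle ⟨m, hm, inf_le_right⟩)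

/-- A filter maximal among those containing `x` and missing `y` works: by maximality, any two
elements outside it have meets with a common member of the filter that lie below `y`. -/
theorem exists_irreducibleFilter {x y : L} (hxy : ¬ x ≤ y) :
    ∃ q : Set L, IsIrreducibleFilter q ∧ x ∈ q ∧ y ∉ q := by
  obtain ⟨M, hM, hxM, hMS, hmax⟩ := (isLatticeFilter_Ici x).exists_maximal
    (S := {w | ¬ w ≤ y}) (fun w hw h => hxy (le_trans hw h)) (fun h hx h' => hx (h.trans h'))
  have hy : y ∉ M := fun h => hMS h le_rfl
  refine ⟨M, ⟨hM, ⟨y, hy⟩, fun {u v} hu hv => ?_⟩, hxM le_rfl, hy⟩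
  obtain ⟨a, ha, hau⟩ := hmax u hu
  obtain ⟨b, hb, hbv⟩ := hmax v hv
  simp only [Set.mem_ofPred_eq, not_not] at hau hbv
  exact ⟨a ⊓ b, hM.inf ha hb, fun h => hMS h (sup_le
    ((inf_le_inf_right _ inf_le_left).trans hau) ((inf_le_inf_right _ inf_le_right).trans hbv))⟩

namespace IsIrreducibleFilter

variable {q : Set L} (hq : IsIrreducibleFilter q)
include hq

/-- Finitely many elements outside an irreducible filter have, after meeting with a suitable
element of the filter, a common upper bound outside the filter. -/
theorem exists_bound (l : List L) (hl : ∀ u ∈ l, u ∉ q) :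
    ∃ a ∈ q, ∃ t, t ∉ q ∧ ∀ u ∈ l, a ⊓ u ≤ t := by
  induction l with
  | nil =>
    obtain ⟨a, ha⟩ := hq.nonempty
    obtain ⟨t, ht⟩ := hq.proper
    exact ⟨a, ha, t, ht, by simp⟩
  | cons v l ih =>
    obtain ⟨a, ha, t, ht, h⟩ := ih fun u hu => hl u (List.mem_cons_of_mem _ hu)
    obtain ⟨b, hb, hbt⟩ := hq.irreducible (hl v List.mem_cons_self) ht
    refine ⟨a ⊓ b, hq.inf ha hb, _, hbt, fun u hu => ?_⟩
    rcases List.mem_cons.1 hu with rfl | hu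
    · exact (inf_le_inf_right _ inf_le_right).trans le_sup_left
    · exact (le_inf (inf_le_left.trans inf_le_right)
        ((inf_le_inf_right _ inf_le_left).trans (h u hu))).trans le_sup_right

/-- Each identity has a free outer meetand. Chosen in `q` by `exists_bound`, it puts every term on
the right below some `t ∉ q`, while the left side is in `q`. This turns the identity into a
disjunction about `q`. -/
theorem mem_of_identityL2 (hL : IdentityL2 L) {b b' c c' : L} (h : (b ⊓ (c ⊔ c')) ⊔ b' ∈ q) :
    b ⊓ (c ⊔ c') ∈ q ∨ (b ⊓ c) ⊔ b' ∈ q ∨ (b ⊓ c') ⊔ b' ∈ q := by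
  by_contra! hcon
  obtain ⟨a, ha, t, ht, hle⟩ := hq.exists_bound
    [b ⊓ (c ⊔ c'), (b ⊓ c) ⊔ b', (b ⊓ c') ⊔ b'] (by simp; tauto)
  simp only [List.forall_mem_cons] at hle
  have := hq.inf ha h
  rw [hL, inf_assoc] at this
  exact ht (hq.upper (sup_le (sup_le hle.1 hle.2.1) hle.2.2.1) this)

theorem mem_of_identityU (hU : IdentityU L) {x₀ x₁ x₂ : L} (h₀₁ : x₀ ⊔ x₁ ∈ q)
    (h₁₂ : x₁ ⊔ x₂ ∈ q) (h₀₂ : x₀ ⊔ x₂ ∈ q) : x₀ ∈ q ∨ x₁ ∈ q ∨ x₂ ∈ q := by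
  by_contra! hcon
  obtain ⟨a, ha, t, ht, hle⟩ := hq.exists_bound [x₀, x₁, x₂] (by simp; tauto)
  simp only [List.forall_mem_cons] at hle
  have := hq.inf (hq.inf (hq.inf ha h₀₁) h₁₂) h₀₂
  rw [hU] at this
  exact ht (hq.upper (sup_le (sup_le (inf_le_left.trans hle.1) (inf_le_left.trans hle.2.1))
    (inf_le_left.trans hle.2.2.1)) this)

theorem mem_of_identityB (hB : IdentityB L) {a₀ a₁ b₀ b₁ : L} (ha : a₀ ⊔ a₁ ∈ q)
    (hb : b₀ ⊔ b₁ ∈ q) (ha₀ : a₀ ∉ q) (ha₁ : a₁ ∉ q) (hb₀ : b₀ ∉ q) (hb₁ : b₁ ∉ q) :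
    (a₀ ⊔ b₀ ∈ q ∧ a₁ ⊔ b₁ ∈ q) ∨ (a₀ ⊔ b₁ ∈ q ∧ a₁ ⊔ b₀ ∈ q) := by
  by_contra hcon
  have key : ∀ {x y : L}, x ⊓ y ∈ q → x ∈ q ∧ y ∈ q := fun h =>
    ⟨hq.upper inf_le_left h, hq.upper inf_le_right h⟩
  obtain ⟨a, ha', t, ht, hle⟩ := hq.exists_bound
    [a₀, a₁, b₀, b₁, (a₀ ⊔ b₀) ⊓ (a₁ ⊔ b₁), (a₀ ⊔ b₁) ⊓ (a₁ ⊔ b₀)] (by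
      simp only [List.forall_mem_cons]
      exact ⟨ha₀, ha₁, hb₀, hb₁, fun h => hcon (.inl (key h)), fun h => hcon (.inr (key h)),
        by simp⟩)
  simp only [List.forall_mem_cons] at hle
  obtain ⟨h1, h2, h3, h4, h5, h6, -⟩ := hle
  have := hq.inf (hq.inf ha' ha) hb
  rw [hB] at this
  refine ht (hq.upper (sup_le (sup_le (sup_le (inf_le_left.trans h1) (inf_le_left.trans h3))
    (sup_le (inf_le_left.trans h2) (inf_le_left.trans h4))) (sup_le ?_ ?_)) this)
  · rw [inf_assoc]
    exact (inf_le_inf_right _ (inf_le_left.trans inf_le_left)).trans h5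
  · rw [inf_assoc]
    exact (inf_le_inf_right _ (inf_le_left.trans inf_le_left)).trans h6

/-- If all joins of `v` with elements of a filter `a ⊈ q` lie in `q`, then `v` can be enlarged to
a prime filter with the same property. -/
theorem exists_primeFilter (hL : IdentityL2 L) {a : Set L} (ha : IsLatticeFilter a)
    (haq : ∃ z ∈ a, z ∉ q) {v : L} (hv : v ∉ q) (h : ∀ z ∈ a, v ⊔ z ∈ q) :
    ∃ b, IsPrimeFilter b ∧ v ∈ b ∧ ∀ w ∈ b, ∀ z ∈ a, w ⊔ z ∈ q := by
  obtain ⟨M, hM, hvM, hMS, hmax⟩ := (isLatticeFilter_Ici v).exists_maximal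
    (S := {w | ∀ z ∈ a, w ⊔ z ∈ q})
    (fun w hw z hz => hq.upper (sup_le_sup_right hw _) (h z hz))
    (fun hxy hx z hz => hq.upper (sup_le_sup_right hxy _) (hx z hz))
  have hvM : v ∈ M := hvM le_rfl
  obtain ⟨z₀, hz₀, hz₀q⟩ := haq
  refine ⟨M, ⟨hM, ⟨z₀, fun h => hz₀q (by simpa using hMS h z₀ hz₀)⟩, fun {c c'} hc => ?_⟩, hvM,
    hMS⟩
  by_contra! hcon
  obtain ⟨w, hw, hwc⟩ := hmax c hcon.1
  obtain ⟨w', hw', hwc'⟩ := hmax c' hcon.2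
  simp only [Set.mem_ofPred_eq, not_forall] at hwc hwc'
  obtain ⟨z, hz, hwz⟩ := hwc
  obtain ⟨z', hz', hwz'⟩ := hwc'
  -- The single element `v ⊓ (w ⊓ w')`, joined with `z ⊓ z'`, is small enough to refute all three
  -- alternatives of (L₂).
  have hx : v ⊓ (w ⊓ w') ∈ M := hM.inf hvM (hM.inf hw hw')
  rcases hq.mem_of_identityL2 hL (b := v ⊓ (w ⊓ w')) (b' := z ⊓ z') (c := c) (c' := c')
    (hMS (hM.inf hx hc) _ (ha.inf hz hz')) with h | h | h
  · exact hv (hq.upper (inf_le_left.trans inf_le_left) h)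
  · exact hwz (hq.upper (sup_le_sup (inf_le_inf_right _ (inf_le_right.trans inf_le_left))
      inf_le_left) h)
  · exact hwz' (hq.upper (sup_le_sup (inf_le_inf_right _ (inf_le_right.trans inf_le_right))
      inf_le_right) h)

/-- `u` is enlarged against the principal filter of `v`, then `v` against the prime filter just
obtained. -/
theorem exists_primeFilter_pair (hL : IdentityL2 L) {u v : L} (hu : u ∉ q) (hv : v ∉ q)
    (huv : u ⊔ v ∈ q) :
    ∃ a b, IsPrimeFilter a ∧ IsPrimeFilter b ∧ u ∈ a ∧ v ∈ b ∧
      ∀ w ∈ a, ∀ z ∈ b, w ⊔ z ∈ q := by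
  obtain ⟨a, ha, hua, h⟩ := hq.exists_primeFilter hL (isLatticeFilter_Ici v) ⟨v, le_rfl, hv⟩ hu
    (fun z hz => hq.upper (sup_le_sup_left hz _) huv)
  obtain ⟨b, hb, hvb, h'⟩ := hq.exists_primeFilter hL ha.toIsLatticeFilter ⟨u, hua, hu⟩ hv
    (fun z hz => sup_comm z v ▸ h z hz v le_rfl)
  exact ⟨a, b, ha, hb, hua, hvb, fun w hw z hz => sup_comm z w ▸ h' z hz w hw⟩

/-- The prime filters involved in the nontrivial join covers of an irreducible filter `q` split
into two sides `A` and `B`, and these covers are given by the pairs in `A × B`. -/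
theorem exists_sides (hL : IdentityL2 L) (hU : IdentityU L) (hB : IdentityB L) :
    ∃ S : Set (Set L) × Set (Set L), (∀ a ∈ S.1, IsPrimeFilter a) ∧ (∀ b ∈ S.2, IsPrimeFilter b) ∧
      Disjoint S.1 S.2 ∧ q ∉ S.1 ∧ q ∉ S.2 ∧ (∀ a ∈ S.1, ∀ b ∈ S.2, a ∩ b ⊆ q) ∧
      ∀ u v, u ∉ q → v ∉ q → u ⊔ v ∈ q →
        ∃ a ∈ S.1, ∃ b ∈ S.2, (u ∈ a ∧ v ∈ b) ∨ (v ∈ a ∧ u ∈ b) := by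
  by_cases hex : ∃ x y, x ∉ q ∧ y ∉ q ∧ x ⊔ y ∈ q
  swap
  · push Not at hex
    exact ⟨(∅, ∅), by simp, by simp, by simp, by simp, by simp, by simp,
      fun u v hu hv huv => absurd huv (hex u v hu hv)⟩
  obtain ⟨x, y, hx, hy, hxy⟩ := hex
  -- The cover `x, y` is a fixed reference edge. An element is on the side of `x` if its join with
  -- `y` is in `q`, and on the side of `y` if its join with `x` is. By (B) the ends of any edge lie
  -- on opposite sides, by (U) no element is on both, and by both identities opposite elements are
  -- always joined.
  have edge : ∀ {z w : L}, z ∉ q → w ∉ q → z ⊔ w ∈ q →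
      (z ⊔ y ∈ q ∧ x ⊔ w ∈ q) ∨ (w ⊔ y ∈ q ∧ x ⊔ z ∈ q) := by
    intro z w hz hw hzw
    rcases hq.mem_of_identityB hB hxy hzw hx hy hz hw with ⟨h1, h2⟩ | ⟨h1, h2⟩
    · exact .inr ⟨sup_comm y w ▸ h2, h1⟩
    · exact .inl ⟨sup_comm y z ▸ h2, h1⟩
  have excl : ∀ {z : L}, z ∉ q → z ⊔ y ∈ q → x ⊔ z ∈ q → False := by
    intro z hz h1 h2
    rcases hq.mem_of_identityU hU h2 h1 hxy with h | h | h <;> contradiction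
  have conv : ∀ {z w : L}, z ∉ q → w ∉ q → z ⊔ y ∈ q → x ⊔ w ∈ q → z ⊔ w ∈ q := by
    intro z w hz hw h1 h2
    rcases hq.mem_of_identityB hB h1 h2 hz hy hx hw with ⟨h3, -⟩ | ⟨h3, -⟩
    · exact (excl hz h1 (sup_comm z x ▸ h3)).elim
    · exact h3
  -- Requiring a member outside `q` excludes `q` itself and makes the two sides disjoint.
  refine ⟨({a | IsPrimeFilter a ∧ (∃ z ∈ a, z ∉ q) ∧ ∀ z ∈ a, z ⊔ y ∈ q},
    {a | IsPrimeFilter a ∧ (∃ z ∈ a, z ∉ q) ∧ ∀ z ∈ a, x ⊔ z ∈ q}), fun a ha => ha.1,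
    fun a ha => ha.1, ?_, ?_, ?_, ?_, ?_⟩
  · rw [Set.disjoint_left]
    rintro a ⟨-, ⟨z, hz, hzq⟩, h1⟩ ⟨-, -, h2⟩
    exact excl hzq (h1 z hz) (h2 z hz)
  · rintro ⟨-, ⟨z, hz, hzq⟩, -⟩
    exact hzq hz
  · rintro ⟨-, ⟨z, hz, hzq⟩, -⟩
    exact hzq hz
  · rintro a ⟨ha, ⟨z, hz, hzq⟩, h1⟩ b ⟨hb, ⟨z', hz', hzq'⟩, h2⟩ w ⟨hwa, hwb⟩
    -- Meeting `w` with the witnesses gives elements outside `q` on opposite sides. Their join is in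
    -- `q` and lies below `w`.
    refine hq.upper (sup_le inf_le_left inf_le_left) (conv (z := w ⊓ z) (w := w ⊓ z')
      (fun h => hzq (hq.upper inf_le_right h)) (fun h => hzq' (hq.upper inf_le_right h))
      (h1 _ (ha.inf hwa hz)) (h2 _ (hb.inf hwb hz')))
  · intro u v hu hv huv
    obtain ⟨a, b, ha, hb, hua, hvb, hab⟩ := hq.exists_primeFilter_pair hL hu hv huv
    -- All elements of two filters covering `q` are on the same sides as `u` and `v`.
    have side : ∀ {a b : Set L} {u v : L}, IsPrimeFilter a → IsPrimeFilter b → u ∈ a → v ∈ b →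
        u ∉ q → v ∉ q → (∀ w ∈ a, ∀ z ∈ b, w ⊔ z ∈ q) → u ⊔ y ∈ q → x ⊔ v ∈ q →
        (∀ z ∈ a, z ⊔ y ∈ q) ∧ ∀ z ∈ b, x ⊔ z ∈ q := by
      intro a b u v ha hb hua hvb hu hv hab h1 h2
      constructor
      · intro z hz
        -- `edge` needs elements outside `q`, so `z` is first cut down by `u`.
        have hzu : z ⊓ u ∉ q := fun h => hu (hq.upper inf_le_right h)
        rcases edge hzu hv (hab _ (ha.inf hz hua) _ hvb) with ⟨h, -⟩ | ⟨h, -⟩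
        · exact hq.upper (sup_le_sup_right inf_le_left _) h
        · exact (excl hv h h2).elim
      · intro z hz
        have hzv : z ⊓ v ∉ q := fun h => hv (hq.upper inf_le_right h)
        rcases edge hu hzv (hab _ hua _ (hb.inf hz hvb)) with ⟨-, h⟩ | ⟨-, h⟩
        · exact hq.upper (sup_le_sup_left inf_le_left _) h
        · exact (excl hu h1 h).elim
    rcases edge hu hv huv with ⟨h1, h2⟩ | ⟨h1, h2⟩
    · obtain ⟨h3, h4⟩ := side ha hb hua hvb hu hv hab h1 h2
      exact ⟨a, ⟨ha, ⟨u, hua, hu⟩, h3⟩, b, ⟨hb, ⟨v, hvb, hv⟩, h4⟩, .inl ⟨hua, hvb⟩⟩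
    · obtain ⟨h3, h4⟩ := side hb ha hvb hua hv hu
        (fun w hw z hz => sup_comm z w ▸ hab z hz w hw) h1 h2
      exact ⟨b, ⟨hb, ⟨v, hvb, hv⟩, h3⟩, a, ⟨ha, ⟨u, hua, hu⟩, h4⟩, .inr ⟨hvb, hua⟩⟩

end IsIrreducibleFilter

end Filters

/-! ### Forests of stars -/

/-- The disjoint union, over `q ∈ S`, of the posets of length at most `2` with one middle point
labelled `q`, minimal points labelled by `A q`, and maximal points labelled by `B q`. A point is
the triple of its centre `q`, its label and its height. -/
def StarForest {α : Type u} (S : Set α) (A B : α → Set α) : Type u :=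
  {t : α × α × Fin 3 // t.1 ∈ S ∧ ((t.2.2 = 0 ∧ t.2.1 ∈ A t.1) ∨ (t.2.2 = 1 ∧ t.2.1 = t.1) ∨
    (t.2.2 = 2 ∧ t.2.1 ∈ B t.1))}

namespace StarForest

variable {α : Type u} {S : Set α} {A B : α → Set α}

/-- The centre of the star of a point. -/
def center (t : StarForest S A B) : α := t.1.1

/-- The label of a point. -/
def label (t : StarForest S A B) : α := t.1.2.1

/-- The height of a point. -/
def height (t : StarForest S A B) : Fin 3 := t.1.2.2

@[ext]
theorem ext {s t : StarForest S A B} (h₁ : s.center = t.center) (h₂ : s.label = t.label)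
    (h₃ : s.height = t.height) : s = t :=
  Subtype.ext (Prod.ext h₁ (Prod.ext h₂ h₃))

instance : PartialOrder (StarForest S A B) where
  le s t := s = t ∨ (s.center = t.center ∧ s.height < t.height)
  le_refl s := .inl rfl
  le_trans := by
    rintro r s t (rfl | ⟨h, h'⟩) (rfl | ⟨k, k'⟩)
    · exact .inl rfl
    · exact .inr ⟨k, k'⟩
    · exact .inr ⟨h, h'⟩
    · exact .inr ⟨h.trans k, h'.trans k'⟩
  le_antisymm := by
    rintro s t (h | ⟨h, h'⟩) (k | ⟨k, k'⟩)
    · exact h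
    · exact h
    · exact k.symm
    · exact absurd h' k'.not_gt

theorem le_iff {s t : StarForest S A B} :
    s ≤ t ↔ s = t ∨ (s.center = t.center ∧ s.height < t.height) := Iff.rfl

theorem lt_iff {s t : StarForest S A B} :
    s < t ↔ s.center = t.center ∧ s.height < t.height := by
  rw [lt_iff_le_and_ne, le_iff]
  constructor
  · rintro ⟨rfl | h, hne⟩
    · exact absurd rfl hne
    · exact h
  · rintro h
    exact ⟨.inr h, by rintro rfl; exact h.2.false⟩

theorem center_mem (t : StarForest S A B) : t.center ∈ S := t.2.1

theorem label_mem_of_height_zero {t : StarForest S A B} (h : t.height = 0) :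
    t.label ∈ A t.center := by
  rcases t.2.2 with ⟨-, h'⟩ | ⟨h', -⟩ | ⟨h', -⟩
  · exact h'
  · exact absurd (h.symm.trans h') (by decide)
  · exact absurd (h.symm.trans h') (by decide)

theorem label_of_height_one {t : StarForest S A B} (h : t.height = 1) : t.label = t.center := by
  rcases t.2.2 with ⟨h', -⟩ | ⟨-, h'⟩ | ⟨h', -⟩
  · exact absurd (h.symm.trans h') (by decide)
  · exact h'
  · exact absurd (h.symm.trans h') (by decide)

theorem label_mem_of_height_two {t : StarForest S A B} (h : t.height = 2) :
    t.label ∈ B t.center := by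
  rcases t.2.2 with ⟨h', -⟩ | ⟨h', -⟩ | ⟨-, h'⟩
  · exact absurd (h.symm.trans h') (by decide)
  · exact absurd (h.symm.trans h') (by decide)
  · exact h'

/-- The middle point of the star of `q`. -/
def middle {q : α} (hq : q ∈ S) : StarForest S A B := ⟨(q, q, 1), hq, .inr (.inl ⟨rfl, rfl⟩)⟩

/-- The minimal point of the star of `q` with label `a`. -/
def lower {q a : α} (hq : q ∈ S) (ha : a ∈ A q) : StarForest S A B :=
  ⟨(q, a, 0), hq, .inl ⟨rfl, ha⟩⟩

/-- The maximal point of the star of `q` with label `b`. -/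
def upper {q b : α} (hq : q ∈ S) (hb : b ∈ B q) : StarForest S A B :=
  ⟨(q, b, 2), hq, .inr (.inr ⟨rfl, hb⟩)⟩

theorem lengthLE : LengthLE 2 (StarForest S A B) := by
  intro C hC
  have hinj : Set.InjOn (height (S := S) (A := A) (B := B)) C := by
    intro s hs t ht hst
    rcases hC.total hs ht with (h | ⟨-, h⟩) | (h | ⟨-, h⟩)
    · exact h
    · exact absurd hst h.ne
    · exact h.symm
    · exact absurd hst h.ne'
  simpa using Finset.card_le_card_of_injOn height (fun _ _ => Finset.mem_univ _) hinj

theorem height_of_covBy {s t : StarForest S A B} (h : s ⋖ t) :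
    s.center = t.center ∧ (s.height = 1 ∧ t.height ≠ 1 ∨ s.height ≠ 1 ∧ t.height = 1) := by
  obtain ⟨hc, hlt⟩ := lt_iff.1 h.lt
  refine ⟨hc, ?_⟩
  by_contra hcon
  have hs : s.height = 0 ∧ t.height = 2 := by
    generalize s.height = i at *
    generalize t.height = j at *
    revert i j
    decide
  -- A lower point is never covered by an upper one, since the middle point of their star lies
  -- strictly between.
  exact h.2 (c := middle s.center_mem) (lt_iff.2 ⟨rfl, by rw [hs.1]; exact Fin.zero_lt_one⟩)
    (lt_iff.2 ⟨hc, by rw [hs.2]; exact (show (1 : Fin 3) < 2 by decide)⟩)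

theorem hasse_adj_cases {s t : StarForest S A B} (h : (SimpleGraph.hasse _).Adj s t) :
    s.center = t.center ∧ (s.height = 1 ∧ t.height ≠ 1 ∨ s.height ≠ 1 ∧ t.height = 1) := by
  rcases h with h | h
  · exact height_of_covBy h
  · have := height_of_covBy h
    exact ⟨this.1.symm, by tauto⟩

/-- A point that is not a middle point is adjacent to at most the middle point of its star. -/
theorem eq_middle_of_adj {s t : StarForest S A B} (h : (SimpleGraph.hasse _).Adj s t)
    (hs : s.height ≠ 1) : t = middle s.center_mem := by
  obtain ⟨hc, ⟨h1, -⟩ | ⟨-, h1⟩⟩ := hasse_adj_cases h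
  · exact absurd h1 hs
  · exact ext hc.symm ((label_of_height_one h1).trans hc.symm) h1

/-- Every edge has an end that is not a middle point, and this end has no other neighbour. Hence
every edge is a bridge. -/
theorem isAcyclic : (SimpleGraph.hasse (StarForest S A B)).IsAcyclic := by
  have bridge : ∀ {s t : StarForest S A B}, (SimpleGraph.hasse _).Adj s t → s.height ≠ 1 →
      (SimpleGraph.hasse (StarForest S A B)).IsBridge s(s, t) := by
    intro s t h hs
    rw [SimpleGraph.isBridge_iff]
    rintro ⟨w⟩
    cases w with
    | nil => exact h.ne rfl
    | cons h' _ =>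
      rw [SimpleGraph.deleteEdges_adj] at h'
      refine h'.2 ?_
      rw [eq_middle_of_adj h hs, eq_middle_of_adj h'.1 hs]
      rfl
  rw [SimpleGraph.isAcyclic_iff_forall_adj_isBridge]
  intro s t h
  by_cases hs : s.height = 1
  · have ht : t.height ≠ 1 := by
      obtain ⟨-, h' | h'⟩ := hasse_adj_cases h
      · exact h'.2
      · exact absurd hs h'.1
    rw [Sym2.eq_swap]
    exact bridge h.symm ht
  · exact bridge h hs

theorem treeLike : TreeLike (StarForest S A B) := by
  refine ⟨fun C hC _ _ => ?_, fun a b p q => (isAcyclic.subsingleton_path a b).elim p q⟩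
  by_contra hinf
  obtain ⟨D, hDC, hD⟩ := Set.Infinite.exists_subset_card_eq hinf 4
  have := lengthLE D (hC.mono hDC)
  omega

theorem finite [Finite α] : Finite (StarForest S A B) := Subtype.finite

/-! ### The homomorphism given by the labels -/

section Embedding

variable {L : Type u} [Lattice L] {S : Set (Set L)} {A B : Set L → Set (Set L)}

theorem label_isLatticeFilter (hS : ∀ q ∈ S, IsIrreducibleFilter q)
    (hA : ∀ q ∈ S, ∀ a ∈ A q, IsPrimeFilter a) (hB : ∀ q ∈ S, ∀ b ∈ B q, IsPrimeFilter b)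
    (t : StarForest S A B) : IsLatticeFilter t.label ∧ ∃ x, x ∉ t.label := by
  rcases t.2.2 with ⟨-, h⟩ | ⟨-, h⟩ | ⟨-, h⟩
  · exact ⟨(hA _ t.2.1 _ h).toIsLatticeFilter, (hA _ t.2.1 _ h).proper⟩
  · have := hS _ t.2.1
    rw [← h] at this
    exact ⟨this.toIsLatticeFilter, this.proper⟩
  · exact ⟨(hB _ t.2.1 _ h).toIsLatticeFilter, (hB _ t.2.1 _ h).proper⟩

/-- The map that sends `x` to the set of all points whose label contains `x`. -/
def hom (S : Set (Set L)) (A B : Set L → Set (Set L)) (hS : ∀ q ∈ S, IsIrreducibleFilter q)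
    (hA : ∀ q ∈ S, ∀ a ∈ A q, IsPrimeFilter a) (hB : ∀ q ∈ S, ∀ b ∈ B q, IsPrimeFilter b)
    (hAB : ∀ q ∈ S, ∀ a ∈ A q, ∀ b ∈ B q, a ∩ b ⊆ q)
    (hcov : ∀ q ∈ S, ∀ u v, u ∉ q → v ∉ q → u ⊔ v ∈ q →
      ∃ a ∈ A q, ∃ b ∈ B q, (u ∈ a ∧ v ∈ b) ∨ (v ∈ a ∧ u ∈ b)) :
    LatticeHom L (Co (StarForest S A B)) where
  toFun x := ⟨{t | x ∈ t.label}, ⟨by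
    rintro r hr t ht s ⟨hrs, hst⟩
    rcases hrs.eq_or_lt with rfl | hrs
    · exact hr
    rcases hst.eq_or_lt with rfl | hst
    · exact ht
    rw [lt_iff] at hrs hst
    -- Convexity matters only at a middle point between a lower and an upper one, where it is the
    -- condition `a ∩ b ⊆ q`.
    have h : r.height = 0 ∧ s.height = 1 ∧ t.height = 2 := by
      have h1 := hrs.2
      have h2 := hst.2
      generalize r.height = i at *
      generalize s.height = j at *
      generalize t.height = k at *
      clear hrs hst
      revert i j k
      decide
    have hra := label_mem_of_height_zero h.1
    have htb := label_mem_of_height_two h.2.2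
    rw [hrs.1] at hra
    rw [← hst.1] at htb
    show x ∈ s.label
    rw [label_of_height_one h.2.1]
    exact hAB _ s.center_mem _ hra _ htb ⟨hr, ht⟩⟩⟩
  map_sup' x y := by
    have hfil := label_isLatticeFilter hS hA hB
    apply le_antisymm
    · intro t (ht : x ⊔ y ∈ t.label)
      have prime : IsPrimeFilter t.label → x ∈ t.label ∨ y ∈ t.label := fun h => h.prime ht
      have easy : x ∈ t.label ∨ y ∈ t.label →
        ∃ r, (x ∈ r.label ∨ y ∈ r.label) ∧ ∃ s, (x ∈ s.label ∨ y ∈ s.label) ∧ r ≤ t ∧ t ≤ s :=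
        fun h => ⟨t, h, t, h, le_rfl, le_rfl⟩
      refine Co.mem_sup.2 ?_
      rcases t.2.2 with ⟨-, h⟩ | ⟨h, -⟩ | ⟨-, h⟩
      · exact easy (prime (hA _ t.2.1 _ h))
      · by_cases hxy : x ∈ t.label ∨ y ∈ t.label
        · exact easy hxy
        rw [label_of_height_one h] at ht hxy
        -- Only at a middle point can the label fail to be prime; a pair from the two sides then
        -- supplies the points below and above it.
        obtain ⟨a, ha, b, hb, hab⟩ := hcov _ t.center_mem x y (fun h => hxy (.inl h))
          (fun h => hxy (.inr h)) ht
        refine ⟨lower t.center_mem ha, ?_, upper t.center_mem hb, ?_, .inr ⟨rfl, ?_⟩,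
          .inr ⟨rfl, ?_⟩⟩
        · exact hab.imp And.left And.left
        · exact hab.symm.imp And.right And.right
        · exact (show (0 : Fin 3) < 1 by decide).trans_eq h.symm
        · exact h.trans_lt (show (1 : Fin 3) < 2 by decide)
      · exact easy (prime (hB _ t.2.1 _ h))
    · exact sup_le (fun t ht => (hfil t).1.upper le_sup_left ht)
        (fun t ht => (hfil t).1.upper le_sup_right ht)
  map_inf' x y := by
    have hfil := label_isLatticeFilter hS hA hB
    apply le_antisymm
    · exact fun t ht => ⟨(hfil t).1.upper inf_le_left ht, (hfil t).1.upper inf_le_right ht⟩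
    · exact fun t ht => (hfil t).1.inf ht.1 ht.2

theorem hom_eq_iff {hS hA hB hAB hcov} {x y : L} :
    hom S A B hS hA hB hAB hcov x = hom S A B hS hA hB hAB hcov y ↔
      ∀ t : StarForest S A B, x ∈ t.label ↔ y ∈ t.label :=
  Subtype.ext_iff.trans Set.ext_iff

/-- Labels are proper, so none contains a least element, and nonempty, so all contain a greatest
one. -/
theorem preservesBounds_hom (hS hA hB hAB hcov) :
    PreservesBounds (hom S A B hS hA hB hAB hcov) := by
  refine ⟨fun x hx => ?_, fun x hx => ?_⟩
  · intro X t ht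
    obtain ⟨hf, y, hy⟩ := label_isLatticeFilter hS hA hB t
    exact absurd (hf.upper (hx y) ht) hy
  · intro X t _
    obtain ⟨hf, -⟩ := label_isLatticeFilter hS hA hB t
    obtain ⟨y, hy⟩ := hf.nonempty
    exact hf.upper (hx y) hy

/-- A forest with only one star gives an embedding that preserves atoms. -/
theorem preservesAtoms_hom {q : Set L} (hS hA hB hAB hcov)
    (hdisj : Disjoint (A q) (B q)) (hqA : q ∉ A q) (hqB : q ∉ B q)
    (hinj : Function.Injective (hom {q} A B hS hA hB hAB hcov)) :
    PreservesAtoms (hom {q} A B hS hA hB hAB hcov) := by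
  rintro x ⟨z, hz, hzx⟩
  set φ := hom {q} A B hS hA hB hAB hcov
  have hφz : IsBot (φ z) := (preservesBounds_hom hS hA hB hAB hcov).1 z hz
  -- A proper filter containing the atom `x` omits the least element, so each of its members meets
  -- `x` in `x` itself.
  have hlab : ∀ t : StarForest {q} A B, x ∈ t.label → t.label = Set.Ici x := by
    intro t ht
    obtain ⟨hf, y, hy⟩ := label_isLatticeFilter hS hA hB t
    refine Set.Subset.antisymm (fun w hw => ?_) (fun w hw => hf.upper hw ht)
    rcases hzx.eq_or_eq (hz _) (inf_le_left : x ⊓ w ≤ x) with h | h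
    · exact absurd (hf.upper (hz y) (h ▸ hf.inf ht hw)) hy
    · exact inf_eq_left.1 h
  -- Within one star the label determines the height, so `φ x` has at most one point.
  have huniq : ∀ s t : StarForest {q} A B, x ∈ s.label → x ∈ t.label → s = t := by
    intro s t hs ht
    have hl : s.label = t.label := (hlab s hs).trans (hlab t ht).symm
    have hsq : s.center = q := s.center_mem
    have htq : t.center = q := t.center_mem
    refine ext (hsq.trans htq.symm) hl ?_
    have hd := Set.disjoint_left.1 hdisj
    have key : ∀ r : StarForest {q} A B, r.height = 0 ∧ r.label ∈ A q ∨
        r.height = 1 ∧ r.label = q ∨ r.height = 2 ∧ r.label ∈ B q := by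
      intro r
      have hr := r.2.2
      have hrq : r.1.1 = q := r.2.1
      rw [hrq] at hr
      exact hr
    have h1 := key s
    have h2 := key t
    rw [hl] at h1
    generalize t.label = l at *
    rcases h1 with ⟨h1, h1'⟩ | ⟨h1, rfl⟩ | ⟨h1, h1'⟩ <;>
      rcases h2 with ⟨h2, h2'⟩ | ⟨h2, h2'⟩ | ⟨h2, h2'⟩ <;> first
        | exact h1.trans h2.symm
        | exact (hd h1' h2').elim
        | exact (hd h2' h1').elim
        | (subst h2'; contradiction)
        | contradiction
  refine ⟨φ z, hφz, ?_, ?_⟩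
  · exact (hφz _).lt_of_ne fun h => hzx.lt.ne (hinj h)
  · intro Y hzY hYx
    obtain ⟨t, htY, -⟩ := Set.exists_of_ssubset (show (φ z).1 ⊂ Y.1 from hzY)
    refine hYx.not_ge fun s hs => ?_
    rw [huniq s t hs (hYx.le htY)]
    exact htY

end Embedding

end StarForest

/-! ### Choosing the forest -/

theorem exists_treeLike_embedding {L : Type u} [Lattice L] (hL : IdentityL2 L)
    (hU : IdentityU L) (hB : IdentityB L) :
    ∃ (Γ : Type u) (_ : PartialOrder Γ) (φ : LatticeHom L (Co Γ)),
      TreeLike Γ ∧ LengthLE 2 Γ ∧ Function.Injective φ ∧ PreservesBounds φ ∧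
      (Finite L → Finite Γ) ∧ (Finite L → SubdirectlyIrreducible L → PreservesAtoms φ) := by
  choose! T hA hB hdisj hqA hqB hAB hcov using
    fun (q : Set L) (hq : IsIrreducibleFilter q) => hq.exists_sides hL hU hB
  let φ (S : Set (Set L)) (hS : ∀ q ∈ S, IsIrreducibleFilter q) :=
    StarForest.hom S (fun q => (T q).1) (fun q => (T q).2) hS (fun q hq => hA q (hS q hq))
      (fun q hq => hB q (hS q hq)) (fun q hq => hAB q (hS q hq)) (fun q hq => hcov q (hS q hq))
  let S₀ : Set (Set L) := {q | IsIrreducibleFilter q}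
  have hinj : Function.Injective (φ S₀ fun q hq => hq) := by
    have key : ∀ x y : L, φ S₀ (fun q hq => hq) x = φ S₀ (fun q hq => hq) y → x ≤ y := by
      intro x y hxy
      by_contra hle
      obtain ⟨q, hq, hx, hy⟩ := exists_irreducibleFilter hle
      exact hy ((StarForest.hom_eq_iff.1 hxy (StarForest.middle (q := q) hq)).1 hx)
    exact fun x y hxy => (key x y hxy).antisymm (key y x hxy.symm)
  -- If one star suffices, it is used. Otherwise all stars are used, and `L` is not subdirectly
  -- irreducible: the least nontrivial congruence would lie in the kernel of every star, hence in
  -- the kernel of an injective map.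
  by_cases hone : ∃ q, ∃ hq : IsIrreducibleFilter q,
      Function.Injective (φ {q} (by rintro _ rfl; exact hq))
  · obtain ⟨q, hq, hqi⟩ := hone
    exact ⟨_, inferInstance, _, StarForest.treeLike, StarForest.lengthLE, hqi,
      StarForest.preservesBounds_hom _ _ _ _ _, fun _ => StarForest.finite,
      fun _ _ => StarForest.preservesAtoms_hom _ _ _ _ _ (hdisj q hq) (hqA q hq) (hqB q hq) hqi⟩
  · refine ⟨_, inferInstance, _, StarForest.treeLike, StarForest.lengthLE, hinj,
      StarForest.preservesBounds_hom _ _ _ _ _, fun _ => StarForest.finite, ?_⟩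
    rintro - ⟨μ, ⟨x, y, hxy, hμ⟩, hmin⟩
    refine (hxy (hinj (StarForest.hom_eq_iff.2 fun t => ?_))).elim
    have hq : IsIrreducibleFilter t.center := t.center_mem
    have hker := hmin (LatticeCon.ker (φ {t.center} (by rintro _ rfl; exact hq))) (by
      by_contra hnon
      refine hone ⟨t.center, hq, fun u v huv => ?_⟩
      by_contra hne
      exact hnon ⟨u, v, hne, huv⟩) x y hμ
    exact StarForest.hom_eq_iff.1 hker ⟨t.1, rfl, t.2.2⟩

theorem mainTheorem2 (L : Type u) [Lattice L] :
    List.TFAE [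
      MemSUB 2 L,
      IdentityL2 L ∧ IdentityU L ∧ IdentityB L,
      ∃ (Γ : Type u) (_ : PartialOrder Γ) (φ : LatticeHom L (Co Γ)),
        TreeLike Γ ∧ LengthLE 2 Γ ∧ Function.Injective φ ∧ PreservesBounds φ ∧
        (Finite L → Finite Γ) ∧
        (Finite L → SubdirectlyIrreducible L → PreservesAtoms φ)] := by
  tfae_have 1 → 2 := MemSUB.identities
  tfae_have 2 → 3 := fun ⟨hL, hU, hB⟩ => exists_treeLike_embedding hL hU hB
  tfae_have 3 → 1 := fun ⟨Γ, i, φ, _, hlen, hinj, _⟩ => ⟨Γ, i, hlen, φ, hinj⟩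
  tfae_finish
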